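/- Let $q\in\mathbb C$ with $0<|q|<1$, and write $(a)_k=(a;q)_k=\prod_{j=0}^{k-1}(1-aq^j)$ for $k\in\mathbb N=\{0,1,2,\dots\}$. For $n\ge 1$ and $x=(x_1,\dots,x_n)$ put $\Delta(x)=\prod_{1\le i<j\le n}(x_i-x_j)$ and $xq^\gamma=(x_1q^{\gamma_1},\dots,x_nq^{\gamma_n})$. For integers $n,m\ge 1$ and $N\in\mathbb N$ define $$ \Phi^{n,m}_N\!\left[\begin{matrix}\{a_i\}_n\\ \{x_i\}_n\end{matrix}\,\middle|\,\begin{matrix}\{b_ky_k\}_m\\ \{cy_k\}_m\end{matrix}\right] :=\sum_{\gamma\in\mathbb N^n,\ |\gamma|=N}\frac{\Delta(xq^\gamma)}{\Delta(x)} \prod_{1\le i,j\le n}\frac{(a_jx_i/x_j)_{\gamma_i}}{(qx_i/x_j)_{\gamma_i}} \prod_{\substack{1\le i\le n\\ 1\le k\le m}}\frac{(b_kx_iy_k/x_ny_m)_{\gamma_i}}{(cx_iy_k/x_ny_m)_{\gamma_i}}, $$ where $|\gamma|=\gamma_1+\dots+\gamma_n$. **Theorem 3.1 (the master formula).** Let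 $n_1,m_1,n_2,m_2\ge 1$ and $N\ge 0$ be integers. Let $a_i,x_i$ $(1\le i\le n_1)$, $b_k,y_k$ $(1\le k\le m_1)$, $e_p,z_p$ $(1\le p\le n_2)$, $d_s,w_s$ $(1\le s\le m_2)$ and $c,f$ be nonzero complex numbers such that no denominator in the formula below vanishes; that is, $q^rx_i\ne x_j$ for $i\ne j$ and $0\le r\le N$, likewise for $y$, $z$ and $w$, and $cq^rx_iy_k/x_{n_1}y_{m_1}\ne 1$ and $fq^rz_pw_s/z_{n_2}w_{m_2}\ne 1$ for all $i,k,p,s$ and all $0\le r<N$. Put $A=a_1\cdots a_{n_1}$, $B=b_1\cdots b_{m_1}$, $D=d_1\cdots d_{m_2}$, $E=e_1\cdots e_{n_2}$, and assume the totally balancing condition $$\frac{AB}{c^{m_1}}=\frac{DE}{f^{n_2}}.$$ Then $$ \sum_{K=0}^{N} \Phi^{n_1,m_1}_K\!\left[\begin{matrix}\{a_i\}_{n_1}\\ \{x_i\}_{n_1}\end{matrix}\,\middle|\,\begin{matrix}\{b_ky_k\}_{m_1}\\ \{cy_k\}_{m_1}\end{matrix}\right] \Phi^{n_2,m_2}_{N-K}\!\left[\begin{matrix}\{f/e_p\}_{n_2}\\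 \{z_p\}_{n_2}\end{matrix}\,\middle|\,\begin{matrix}\{(f/d_s)w_s\}_{m_2}\\ \{fw_s\}_{m_2}\end{matrix}\right] \left(\frac{DE}{f^{n_2}}\right)^{N-K} $$ $$ =\sum_{L=0}^{N} \Phi^{m_1,n_1}_L\!\left[\begin{matrix}\{c/b_k\}_{m_1}\\ \{y_k\}_{m_1}\end{matrix}\,\middle|\,\begin{matrix}\{(c/a_i)x_i\}_{n_1}\\ \{cx_i\}_{n_1}\end{matrix}\right] \Phi^{m_2,n_2}_{N-L}\!\left[\begin{matrix}\{d_s\}_{m_2}\\ \{w_s\}_{m_2}\end{matrix}\,\middle|\,\begin{matrix}\{e_pz_p\}_{n_2}\\ \{fz_p\}_{n_2}\end{matrix}\right] \left(\frac{AB}{c^{m_1}}\right)^{L}. $$ -/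

import Mathlib

open Finset

/-- The `q`-shifted factorial `(a)_k = (a; q)_k = ∏_{0 ≤ j < k} (1 - a q^j)` for `k ∈ ℕ`,
that is, `(a; q)_∞ / (a q^k; q)_∞` after cancellation of the common factors. -/
noncomputable def qShifted (q a : ℂ) (k : ℕ) : ℂ :=
  ∏ j ∈ range k, (1 - a * q ^ j)

/-- The Vandermonde product `Δ(x) = ∏_{i < j} (x_i - x_j)`. -/
noncomputable def vdm {n : ℕ} (x : Fin n → ℂ) : ℂ :=
  ∏ i : Fin n, ∏ j ∈ Ioi i, (x i - x j)

/-- The last index (`n` in the numbering `1, …, n`) of a nonempty `Fin n`. -/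
def lastIdx (n : ℕ) [NeZero n] : Fin n := ⟨n - 1, Nat.sub_one_lt (NeZero.ne n)⟩

/-- The homogeneous part of degree `N` of the `A_n` basic hypergeometric series,
`Φ^{n,m}_N [{a_i}, {x_i} ; {b_k y_k}, {c y_k}]`
`= ∑_{γ ∈ ℕ^n, |γ| = N} Δ(x q^γ) / Δ(x)`
`  * ∏_{i,j ≤ n} (a_j x_i / x_j)_{γ_i} / (q x_i / x_j)_{γ_i}`
`  * ∏_{i ≤ n, k ≤ m} (b_k x_i y_k / (x_n y_m))_{γ_i} / (c x_i y_k / (x_n y_m))_{γ_i}`. -/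
noncomputable def homPart (q : ℂ) {n m : ℕ} [NeZero n] [NeZero m]
    (a x : Fin n → ℂ) (b y : Fin m → ℂ) (c : ℂ) (N : ℕ) : ℂ :=
  ∑ γ ∈ piAntidiag (univ : Finset (Fin n)) N,
    vdm (fun i => x i * q ^ γ i) / vdm x
      * (∏ i, ∏ j, qShifted q (a j * x i / x j) (γ i) / qShifted q (q * x i / x j) (γ i))
      * ∏ i, ∏ k,
          qShifted q (b k * x i * y k / (x (lastIdx n) * y (lastIdx m))) (γ i)
            / qShifted q (c * x i * y k / (x (lastIdx n) * y (lastIdx m))) (γ i)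

/-! Put t = AB/c^{m₁} = DE/f^{n₂}. Kajihara's Euler transformation says that the generating function
in u of the homogeneous parts is (tu)_∞/(u)_∞ times that of the dual series in tu; `homPart_euler`
is its coefficientwise form. The balancing condition makes the q-binomial factor the same for the
series (a, x; b, y; c) and (d, w; e, z; f). Both sides of the master formula are therefore the
coefficient of u^N in one product: this factor times the two dual series in tu. It is attached to
the first dual series on the left and to the second on the right (`sum_antidiagonal_triple`).

The Euler transformation (`homSum_euler`) goes by induction on the degree, since both sides obey one
recurrence: degree M + 1 is expressed through degree M at (b, Y) and at the points where (b_k, Y_k)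
becomes (b_k/q, q Y_k). On the left (`homSum_succ`), partial fractions split 1 - q^{|γ|} into
weights, the i-th of which allows γ_i to be lowered; a second expansion trades the resulting sum
over i for residues at the dual variables. On the right, the same splitting for the dual series
(`sum_dualCoeff_mul_homSum`) meets a contiguous relation of q-binomial coefficients
(`sum_qBinomCoeff_recurrence`). Every partial fraction used is an instance of
`sum_prod_one_sub_div`. -/

/-! ### Partial fractions and finite products -/

/-- Interpolating the monic polynomial ∏ (X - α_j) at 0 and at the β_i, one node more than its
degree, recovers its leading coefficient 1. The node 0 contributes ∏ α_j / ∏ β_j. -/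
theorem sum_prod_one_sub_div {ι F : Type*} [Field F] [Fintype ι] [DecidableEq ι] (α β : ι → F)
    (hβ : ∀ i, β i ≠ 0) (hinj : Function.Injective β) :
    ∑ i, (∏ j, (1 - α j / β i)) / ∏ j ∈ univ.erase i, (1 - β j / β i)
      = 1 - (∏ j, α j) / ∏ j, β j := by
  -- `none` indexes the extra node 0, which is why the β_i must be nonzero.
  have key := Lagrange.leadingCoeff_eq_sum (F := F) (s := (univ : Finset (Option ι)))
    (v := fun o => o.elim 0 β) (P := ∏ j, (Polynomial.X - Polynomial.C (α j)))
    (by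
      rintro (_ | i) - (_ | j) - h
      · rfl
      · exact absurd h.symm (hβ j)
      · exact absurd h (hβ i)
      · exact congrArg some (hinj h))
    (by simp [Polynomial.degree_prod])
  rw [Polynomial.leadingCoeff_prod] at key
  simp only [Polynomial.leadingCoeff_X_sub_C, prod_const_one, Fintype.sum_option,
    Option.elim_none, Option.elim_some, Polynomial.eval_prod, Polynomial.eval_sub,
    Polynomial.eval_X, Polynomial.eval_C, zero_sub] at key
  have hnone : (univ : Finset (Option ι)).erase none = univ.map Function.Embedding.some := by
    ext (_ | j) <;> simp
  have hsome (i : ι) : (univ : Finset (Option ι)).erase (some i)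
      = insert none ((univ.erase i).map Function.Embedding.some) := by
    ext (_ | j) <;> simp
  rw [hnone, prod_map] at key
  have h0 : (∏ j, -α j) / ∏ j, -(Option.elim (Function.Embedding.some j) 0 β)
      = (∏ j, α j) / ∏ j, β j := by
    rw [← prod_div_distrib, ← prod_div_distrib]
    exact prod_congr rfl fun j _ => by simp [neg_div_neg_eq]
  rw [h0] at key
  rw [eq_sub_iff_add_eq, add_comm]
  refine Eq.trans ?_ key.symm
  congr 1
  refine sum_congr rfl fun i _ => ?_
  rw [hsome, prod_insert (by simp), prod_map]
  simp only [Option.elim_none, sub_zero, Function.Embedding.some_apply, Option.elim_some]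
  have hn : ∏ j, (β i - α j) = (β i * ∏ j ∈ univ.erase i, β i) * ∏ j, (1 - α j / β i) := by
    rw [mul_prod_erase univ (fun _ => β i) (mem_univ i), ← prod_mul_distrib]
    exact prod_congr rfl fun j _ => by field_simp [hβ i]
  have hd : ∏ j ∈ univ.erase i, (β i - β j)
      = (∏ j ∈ univ.erase i, β i) * ∏ j ∈ univ.erase i, (1 - β j / β i) := by
    rw [← prod_mul_distrib]
    exact prod_congr rfl fun j _ => by field_simp [hβ i]
  rw [hn, hd, ← mul_assoc, mul_div_mul_left]
  exact mul_ne_zero (hβ i) (prod_ne_zero_iff.2 fun _ _ => hβ i)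

theorem prod_erase_inl {ι κ M : Type*} [Fintype ι] [Fintype κ] [DecidableEq ι] [DecidableEq κ]
    [CommMonoid M] (i : ι) (f : ι ⊕ κ → M) :
    ∏ j ∈ univ.erase (Sum.inl i), f j
      = (∏ j ∈ univ.erase i, f (Sum.inl j)) * ∏ k, f (Sum.inr k) := by
  rw [← prod_disjSum]
  congr 1
  ext (j | k) <;> simp

theorem prod_erase_inr {ι κ M : Type*} [Fintype ι] [Fintype κ] [DecidableEq ι] [DecidableEq κ]
    [CommMonoid M] (k : κ) (f : ι ⊕ κ → M) :
    ∏ j ∈ univ.erase (Sum.inr k), f j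
      = (∏ i, f (Sum.inl i)) * ∏ l ∈ univ.erase k, f (Sum.inr l) := by
  rw [← prod_disjSum]
  congr 1
  ext (j | k) <;> simp

theorem prod_eq_prod_mul_of_eq_off {ι M : Type*} [Fintype ι] [DecidableEq ι] [CommMonoid M]
    {f g : ι → M} {r : M} (i : ι) (hoff : ∀ j, j ≠ i → g j = f j) (hi : g i = f i * r) :
    ∏ j, g j = (∏ j, f j) * r := by
  rw [← mul_prod_erase univ g (mem_univ i), ← mul_prod_erase univ f (mem_univ i), hi,
    prod_congr rfl fun j hj => hoff j (ne_of_mem_erase hj)]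
  exact mul_right_comm _ _ _

theorem prod_update_div {n : ℕ} {F : Type*} [Field F] (b : Fin n → F) (k : Fin n) (r : F) :
    ∏ l, Function.update b k (b k * r) l = (∏ l, b l) * r :=
  prod_eq_prod_mul_of_eq_off k (fun l hl => by simp [hl]) (by simp)

/-- When one variable moves, only the pairs containing its index change; symmetry of `r` lets such
pairs be read with `i` first. -/
theorem prod_Ioi_eq_prod_erase {n : ℕ} {M : Type*} [CommMonoid M] (r : Fin n → Fin n → M)
    (hsymm : ∀ a b, r a b = r b a) (i : Fin n) (hr : ∀ a b, a ≠ b → a ≠ i → b ≠ i → r a b = 1) :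
    ∏ a, ∏ b ∈ Ioi a, r a b = ∏ b ∈ univ.erase i, r i b := by
  have h1 (a : Fin n) (ha : a ∈ univ.erase i) :
      ∏ b ∈ Ioi a, r a b = if a < i then r i a else 1 := by
    have ha := ne_of_mem_erase ha
    split_ifs with h
    · rw [prod_eq_single_of_mem i (mem_Ioi.2 h) fun b hab hb => hr a b (mem_Ioi.1 hab).ne ha hb, hsymm]
    · refine prod_eq_one fun b hb => hr a b (mem_Ioi.1 hb).ne ha ?_
      rintro rfl
      exact h (mem_Ioi.1 hb)
  have h2 : ∏ b ∈ Ioi i, r i b = ∏ b ∈ univ.erase i, if i < b then r i b else 1 := by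
    rw [← prod_filter]
    refine prod_congr ?_ fun _ _ => rfl
    ext b
    simp only [mem_Ioi, mem_filter, mem_erase, mem_univ, and_true]
    exact ⟨fun h => ⟨h.ne', h⟩, fun h => h.2⟩
  rw [← mul_prod_erase univ _ (mem_univ i), prod_congr rfl h1, h2, ← prod_mul_distrib]
  refine prod_congr rfl fun b hb => ?_
  rcases lt_or_gt_of_ne (ne_of_mem_erase hb) with h | h
  · simp [h, h.not_gt]
  · simp [h, h.not_gt]

/-! ### Vandermonde products, shifted factorials, and index shifts -/

theorem vdm_ne_zero {n : ℕ} {x : Fin n → ℂ} (hx : Function.Injective x) : vdm x ≠ 0 :=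
  prod_ne_zero_iff.2 fun _ _ => prod_ne_zero_iff.2 fun _ hj =>
    sub_ne_zero.2 fun h => (mem_Ioi.1 hj).ne (hx h)

theorem vdm_update {n : ℕ} {x : Fin n → ℂ} (hx : Function.Injective x) (i : Fin n) (v : ℂ) :
    vdm (Function.update x i v)
      = vdm x * ∏ j ∈ univ.erase i, (v - x j) / (x i - x j) := by
  have hs : ∏ j ∈ univ.erase i, (v - x j) / (x i - x j)
      = ∏ j ∈ univ.erase i, (Function.update x i v i - Function.update x i v j) / (x i - x j) :=
    prod_congr rfl fun j hj => by
      rw [Function.update_self, Function.update_of_ne (ne_of_mem_erase hj)]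
  rw [hs, ← prod_Ioi_eq_prod_erase
    (fun a b => (Function.update x i v a - Function.update x i v b) / (x a - x b))
    (fun a b => by
      rw [← neg_div_neg_eq, neg_sub, neg_sub])
    i (fun a b hab ha hb => ?_)]
  · unfold vdm
    rw [← prod_mul_distrib]
    refine prod_congr rfl fun a _ => ?_
    rw [← prod_mul_distrib]
    refine prod_congr rfl fun b hb => ?_
    rw [mul_div_cancel₀ _ (sub_ne_zero.2 fun h => (mem_Ioi.1 hb).ne (hx h))]
  · rw [Function.update_of_ne ha, Function.update_of_ne hb,
      div_self (sub_ne_zero.2 fun h => hab (hx h))]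

theorem vdm_smul_ratio {n : ℕ} {s : ℂ} (hs : s ≠ 0) (x u : Fin n → ℂ) :
    vdm (fun i => s * x i * u i) / vdm (fun i => s * x i) = vdm (fun i => x i * u i) / vdm x := by
  simp only [vdm, ← prod_div_distrib]
  refine prod_congr rfl fun i _ => prod_congr rfl fun j _ => ?_
  rw [mul_assoc, mul_assoc, ← mul_sub, ← mul_sub, mul_div_mul_left _ _ hs]

theorem qShifted_zero (q a : ℂ) : qShifted q a 0 = 1 := by simp [qShifted]

theorem qShifted_succ (q a : ℂ) (k : ℕ) :
    qShifted q a (k + 1) = qShifted q a k * (1 - a * q ^ k) := prod_range_succ _ _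

theorem qShifted_succ' (q a : ℂ) (k : ℕ) :
    qShifted q a (k + 1) = (1 - a) * qShifted q (a * q) k := by
  rw [qShifted, prod_range_succ', mul_comm]
  simp [qShifted, pow_succ', mul_assoc]

theorem qShifted_ne_zero {q a : ℂ} {k : ℕ} (h : ∀ r < k, a * q ^ r ≠ 1) : qShifted q a k ≠ 0 :=
  prod_ne_zero_iff.2 fun r hr => sub_ne_zero.2 (h r (mem_range.1 hr)).symm

/-- Terms with γ_i = 0 drop out, and all others are raised from degree N in a unique way. -/
theorem sum_piAntidiag_succ {n : ℕ} {M : Type*} [AddCommMonoid M] (N : ℕ) (i : Fin n)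
    (f : (Fin n → ℕ) → M) (hf : ∀ γ, γ i = 0 → f γ = 0) :
    ∑ γ ∈ piAntidiag univ (N + 1), f γ
      = ∑ γ ∈ piAntidiag univ N, f (Function.update γ i (γ i + 1)) := by
  have hsum (γ : Fin n → ℕ) (m : ℕ) : univ.sum (Function.update γ i m) + γ i = univ.sum γ + m := by
    rw [sum_update_of_mem (mem_univ i), ← erase_eq, ← add_sum_erase univ γ (mem_univ i)]
    ring
  symm
  refine sum_bij_ne_zero (fun γ _ _ => Function.update γ i (γ i + 1)) ?_ ?_ ?_ ?_
  · intro γ h _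
    have := hsum γ (γ i + 1)
    simp only [mem_piAntidiag, mem_univ, implies_true, and_true] at h ⊢
    omega
  · intro γ _ _ δ _ _ h
    ext j
    have hj := congrFun h j
    by_cases hji : j = i
    · subst hji
      simpa using hj
    · simpa [hji] using hj
  · intro γ h hne
    have hi : γ i ≠ 0 := fun h0 => hne (hf γ h0)
    have hup : Function.update (Function.update γ i (γ i - 1)) i
        (Function.update γ i (γ i - 1) i + 1) = γ := by
      rw [Function.update_self, Function.update_idem, Nat.sub_add_cancel (Nat.pos_of_ne_zero hi),
        Function.update_eq_self]
    refine ⟨Function.update γ i (γ i - 1), ?_, ?_, hup⟩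
    · have := hsum γ (γ i - 1)
      simp only [mem_piAntidiag, mem_univ, implies_true, and_true] at h ⊢
      omega
    · rwa [hup]
  · intro _ _ _
    rfl

/-- The summand of `homPart`, with the normalisation of the second set of variables removed. -/
noncomputable def homTerm (q : ℂ) {n m : ℕ} (a x : Fin n → ℂ) (b Y : Fin m → ℂ) (c : ℂ)
    (γ : Fin n → ℕ) : ℂ :=
  vdm (fun i => x i * q ^ γ i) / vdm x
    * (∏ i, ∏ j, qShifted q (a j * x i / x j) (γ i) / qShifted q (q * x i / x j) (γ i))
    * ∏ i, ∏ k, qShifted q (b k * x i * Y k) (γ i) / qShifted q (c * x i * Y k) (γ i)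

/-! ### Moving one index or one variable in a single term -/

theorem shifted_point_update {n : ℕ} (q : ℂ) (x : Fin n → ℂ) (γ : Fin n → ℕ) (i : Fin n) :
    (fun j => x j * q ^ Function.update γ i (γ i + 1) j)
      = Function.update (fun j => x j * q ^ γ j) i (q * (x i * q ^ γ i)) := by
  ext j
  by_cases h : j = i
  · subst h
    simp only [Function.update_self]
    ring
  · simp [h]

/-- The weight on the left is the i-th summand of `sum_raise_coeff` at the raised index. It cancels
the new factors 1 - q X_i/x_j of the denominators, where X_i = x_i q^{γ_i}, and the new Vandermonde
numerator. -/
theorem homTerm_raise {q : ℂ} {n m : ℕ} (a : Fin n → ℂ) {x : Fin n → ℂ} (b Y : Fin m → ℂ)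
    (c : ℂ) (γ : Fin n → ℕ) (i : Fin n) (hq : q ≠ 0) (hx : ∀ j, x j ≠ 0)
    (hinj : Function.Injective fun j => x j * q ^ γ j)
    (h1 : ∀ j, 1 - q * (x i * q ^ γ i) / x j ≠ 0)
    (h2 : ∀ j, j ≠ i → 1 - q * (x i * q ^ γ i) / (x j * q ^ γ j) ≠ 0) :
    homTerm q a x b Y c (Function.update γ i (γ i + 1))
        * ((∏ j, (1 - q * (x i * q ^ γ i) / x j))
          / ∏ j ∈ univ.erase i, (1 - q * (x i * q ^ γ i) / (x j * q ^ γ j)))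
      = homTerm q a x b Y c γ
        * ((∏ j, (1 - a j * (x i * q ^ γ i) / x j))
          / (∏ j ∈ univ.erase i, (1 - x i * q ^ γ i / (x j * q ^ γ j)))
          * ∏ k, (1 - b k * (x i * q ^ γ i) * Y k) / (1 - c * (x i * q ^ γ i) * Y k)) := by
  have hV := vdm_update hinj i (q * (x i * q ^ γ i))
  rw [← shifted_point_update] at hV
  have hP : ∏ r, ∏ j, qShifted q (a j * x r / x j) (Function.update γ i (γ i + 1) r)
        / qShifted q (q * x r / x j) (Function.update γ i (γ i + 1) r)
      = (∏ r, ∏ j, qShifted q (a j * x r / x j) (γ r) / qShifted q (q * x r / x j) (γ r))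
        * ∏ j, (1 - a j * (x i * q ^ γ i) / x j) / (1 - q * (x i * q ^ γ i) / x j) := by
    refine prod_eq_prod_mul_of_eq_off i (fun r hr => by simp [hr]) ?_
    rw [← prod_mul_distrib]
    refine prod_congr rfl fun j _ => ?_
    rw [Function.update_self, qShifted_succ, qShifted_succ, div_mul_div_comm]
    congr 2 <;> ring
  have hQ : ∏ r, ∏ k, qShifted q (b k * x r * Y k) (Function.update γ i (γ i + 1) r)
        / qShifted q (c * x r * Y k) (Function.update γ i (γ i + 1) r)
      = (∏ r, ∏ k, qShifted q (b k * x r * Y k) (γ r) / qShifted q (c * x r * Y k) (γ r))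
        * ∏ k, (1 - b k * (x i * q ^ γ i) * Y k) / (1 - c * (x i * q ^ γ i) * Y k) := by
    refine prod_eq_prod_mul_of_eq_off i (fun r hr => by simp [hr]) ?_
    rw [← prod_mul_distrib]
    refine prod_congr rfl fun k _ => ?_
    rw [Function.update_self, qShifted_succ, qShifted_succ, div_mul_div_comm]
    congr 2 <;> ring
  have hE : ∏ j ∈ univ.erase i,
        (q * (x i * q ^ γ i) - x j * q ^ γ j) / (x i * q ^ γ i - x j * q ^ γ j)
      = (∏ j ∈ univ.erase i, (1 - q * (x i * q ^ γ i) / (x j * q ^ γ j)))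
        / ∏ j ∈ univ.erase i, (1 - x i * q ^ γ i / (x j * q ^ γ j)) := by
    rw [← prod_div_distrib]
    refine prod_congr rfl fun j _ => ?_
    have hj : x j * q ^ γ j ≠ 0 := mul_ne_zero (hx j) (pow_ne_zero _ hq)
    rw [one_sub_div hj, one_sub_div hj, div_div_div_cancel_right₀ hj, ← neg_div_neg_eq, neg_sub,
      neg_sub]
  have n1 : ∏ j, (1 - q * (x i * q ^ γ i) / x j) ≠ 0 := prod_ne_zero_iff.2 fun j _ => h1 j
  have n2 : ∏ j ∈ univ.erase i, (1 - q * (x i * q ^ γ i) / (x j * q ^ γ j)) ≠ 0 :=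
    prod_ne_zero_iff.2 fun j hj => h2 j (ne_of_mem_erase hj)
  unfold homTerm
  rw [hV, hP, hQ, hE, prod_div_distrib (s := univ) (f := fun j => 1 - a j * (x i * q ^ γ i) / x j)]
  have alg (V W P A Q C D₁ D₂ D₃ : ℂ) (hD₁ : D₁ ≠ 0) (hD₂ : D₂ ≠ 0) :
      V * (D₂ / D₃) / W * (P * (A / D₁)) * (Q * C) * (D₁ / D₂) = V / W * P * Q * (A / D₃ * C) := by
    field_simp
  exact alg _ _ _ _ _ _ _ _ _ n1 n2

/-- The products b_k Y_k are unchanged by the shift, so only (c x_i Y_k)_{γ_i} moves, and its ratio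
telescopes to two factors. -/
theorem homTerm_update_dual {q : ℂ} {n m : ℕ} (a x : Fin n → ℂ) (b Y : Fin m → ℂ)
    (c : ℂ) (γ : Fin n → ℕ) (k : Fin m) (hq : q ≠ 0)
    (h0 : ∀ i, 1 - c * x i * Y k ≠ 0) :
    homTerm q a x (Function.update b k (b k * q⁻¹)) (Function.update Y k (Y k * q)) c γ
      = homTerm q a x b Y c γ
        * ∏ i, (1 - c * x i * Y k) / (1 - c * (x i * q ^ γ i) * Y k) := by
  unfold homTerm
  refine (congrArg _ ?_).trans (mul_assoc _ _ _).symm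
  rw [← prod_mul_distrib]
  refine prod_congr rfl fun i _ => prod_eq_prod_mul_of_eq_off k (fun l hl => by simp [hl]) ?_
  rw [Function.update_self, Function.update_self]
  have e : qShifted q (c * x i * Y k) (γ i) * (1 - c * (x i * q ^ γ i) * Y k)
      = (1 - c * x i * Y k) * qShifted q (c * x i * (Y k * q)) (γ i) := by
    rw [← mul_assoc (c * x i), ← qShifted_succ', qShifted_succ]
    ring
  have hb : b k * q⁻¹ * x i * (Y k * q) = b k * x i * Y k := by
    field_simp
  rw [hb, div_mul_div_comm, e, mul_comm (1 - c * x i * Y k), mul_div_mul_right _ _ (h0 i)]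

/-- Raising γ_i and replacing x_i by q x_i lead to the same point x q^γ, and a_i/x_i is kept fixed.
Row i of the double product loses its first factors, while the other rows change only in column i,
through (q x_r/x_i)_{γ_r}. -/
theorem homTerm_raise_eq_update {q : ℂ} {n m : ℕ} (a : Fin n → ℂ) {x : Fin n → ℂ}
    (b Y : Fin m → ℂ) (c : ℂ) (γ : Fin n → ℕ) (i : Fin n) (hq : q ≠ 0) (hx : ∀ j, x j ≠ 0)
    (hinj : Function.Injective x) (hinj' : Function.Injective (Function.update x i (x i * q)))
    (h1 : ∀ j, j ≠ i → 1 - x j * q ^ γ j / x i ≠ 0) (h2 : 1 - q ^ (γ i + 1) ≠ 0) :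
    homTerm q a x b Y c (Function.update γ i (γ i + 1))
        * ((∏ j, (1 - x j * q ^ Function.update γ i (γ i + 1) j / x i))
          / ∏ j ∈ univ.erase i, (1 - x j / x i))
      = homTerm q (Function.update a i (a i * q)) (Function.update x i (x i * q)) b Y c γ
        * ((∏ j, (1 - a j * x i / x j)) / (∏ j ∈ univ.erase i, (1 - x i / x j))
          * ∏ k, (1 - b k * x i * Y k) / (1 - c * x i * Y k)) := by
  have hV := vdm_update hinj i (x i * q)
  have hne (j : Fin n) (hj : j ≠ i) : 1 - x j / x i ≠ 0 := by
    rw [one_sub_div (hx i)]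
    exact div_ne_zero (sub_ne_zero.2 fun h => hj (hinj h.symm)) (hx i)
  have hpt : (fun j => x j * q ^ Function.update γ i (γ i + 1) j)
      = fun j => Function.update x i (x i * q) j * q ^ γ j := by
    ext j
    by_cases h : j = i
    · subst h
      simp only [Function.update_self]
      ring
    · simp [h]
  have hq1 (j : Fin n) (hj : j ≠ i) : 1 - q * x i / x j ≠ 0 := by
    rw [one_sub_div (hx j)]
    refine div_ne_zero (sub_ne_zero.2 fun h => hj (hinj' ?_)) (hx j)
    simp [hj, h, mul_comm]
  have hP : ∏ r, ∏ j, qShifted q (a j * x r / x j) (Function.update γ i (γ i + 1) r)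
        / qShifted q (q * x r / x j) (Function.update γ i (γ i + 1) r)
      = (∏ r, ∏ j, qShifted q (Function.update a i (a i * q) j
            * Function.update x i (x i * q) r / Function.update x i (x i * q) j) (γ r)
          / qShifted q (q * Function.update x i (x i * q) r
            / Function.update x i (x i * q) j) (γ r))
        * ((∏ j, (1 - a j * x i / x j))
          / ((1 - q ^ (γ i + 1)) * ∏ j ∈ univ.erase i, (1 - q * x i / x j))
          * ∏ r ∈ univ.erase i, (1 - x r / x i) / (1 - x r * q ^ γ r / x i)) := by
    rw [← mul_prod_erase univ _ (mem_univ i),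
      ← mul_prod_erase univ (fun r => ∏ j, qShifted q (Function.update a i (a i * q) j
            * Function.update x i (x i * q) r / Function.update x i (x i * q) j) (γ r)
          / qShifted q (q * Function.update x i (x i * q) r
            / Function.update x i (x i * q) j) (γ r)) (mem_univ i), mul_mul_mul_comm,
      ← prod_mul_distrib]
    congr 1
    · simp only [Function.update_self]
      rw [← mul_prod_erase univ _ (mem_univ i),
        ← mul_prod_erase univ (fun j => 1 - a j * x i / x j) (mem_univ i),
        ← mul_prod_erase univ (fun j => qShifted q (Function.update a i (a i * q) j
            * (x i * q) / Function.update x i (x i * q) j) (γ i)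
          / qShifted q (q * (x i * q) / Function.update x i (x i * q) j) (γ i)) (mem_univ i),
        mul_div_mul_comm, mul_mul_mul_comm, ← prod_div_distrib, ← prod_mul_distrib]
      congr 1
      · have e1 : q * x i / x i = q := mul_div_cancel_right₀ _ (hx i)
        have e2 : q * (x i * q) / (x i * q) = q :=
          mul_div_cancel_right₀ _ (mul_ne_zero (hx i) hq)
        have e3 : a i * q * (x i * q) / (x i * q) = a i * x i / x i * q := by
          field_simp [hx i]
        simp only [Function.update_self]
        rw [e1, e2, e3, qShifted_succ', qShifted_succ, pow_succ', mul_comm (1 - _),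
          div_mul_div_comm]
      · refine prod_congr rfl fun j hj => ?_
        have hj := ne_of_mem_erase hj
        rw [Function.update_of_ne hj, Function.update_of_ne hj, qShifted_succ', qShifted_succ',
          mul_div_mul_comm, mul_comm]
        congr 3 <;> ring
    · refine prod_congr rfl fun r hr => ?_
      have hr := ne_of_mem_erase hr
      refine prod_eq_prod_mul_of_eq_off i (fun j hj => by simp [hj, hr]) ?_
      simp only [Function.update_self, Function.update_of_ne hr]
      have e1 : a i * q * x r / (x i * q) = a i * x r / x i := by
        field_simp [hx i]
      have e2 : q * x r / (x i * q) = x r / x i := by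
        field_simp [hx i]
      have e3 : q * x r / x i = x r / x i * q := by ring
      have e : qShifted q (x r / x i) (γ r) * (1 - x r * q ^ γ r / x i)
          = (1 - x r / x i) * qShifted q (x r / x i * q) (γ r) := by
        rw [← qShifted_succ', qShifted_succ]
        ring
      rw [e1, e2, e3, div_mul_div_comm, e, mul_comm (1 - x r / x i),
        mul_div_mul_right _ _ (hne r hr)]
  have hQ : ∏ r, ∏ k, qShifted q (b k * x r * Y k) (Function.update γ i (γ i + 1) r)
        / qShifted q (c * x r * Y k) (Function.update γ i (γ i + 1) r)
      = (∏ r, ∏ k, qShifted q (b k * Function.update x i (x i * q) r * Y k) (γ r)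
          / qShifted q (c * Function.update x i (x i * q) r * Y k) (γ r))
        * ∏ k, (1 - b k * x i * Y k) / (1 - c * x i * Y k) := by
    refine prod_eq_prod_mul_of_eq_off i (fun r hr => by simp [hr]) ?_
    rw [← prod_mul_distrib]
    refine prod_congr rfl fun k _ => ?_
    rw [Function.update_self, Function.update_self, qShifted_succ', qShifted_succ',
      mul_div_mul_comm, mul_comm]
    congr 3 <;> ring
  have hE : ∏ j ∈ univ.erase i, (x i * q - x j) / (x i - x j)
      = (∏ j ∈ univ.erase i, (1 - q * x i / x j)) / ∏ j ∈ univ.erase i, (1 - x i / x j) := by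
    rw [← prod_div_distrib]
    refine prod_congr rfl fun j _ => ?_
    rw [one_sub_div (hx j), one_sub_div (hx j), div_div_div_cancel_right₀ (hx j),
      ← neg_div_neg_eq, neg_sub, neg_sub, mul_comm q]
  have hN : ∏ j, (1 - x j * q ^ Function.update γ i (γ i + 1) j / x i)
      = (1 - q ^ (γ i + 1)) * ∏ j ∈ univ.erase i, (1 - x j * q ^ γ j / x i) := by
    rw [← mul_prod_erase univ _ (mem_univ i), Function.update_self,
      mul_div_cancel_left₀ _ (hx i)]
    congr 1
    exact prod_congr rfl fun j hj => by rw [Function.update_of_ne (ne_of_mem_erase hj)]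
  have n1 : ∏ j ∈ univ.erase i, (1 - x j / x i) ≠ 0 :=
    prod_ne_zero_iff.2 fun j hj => hne j (ne_of_mem_erase hj)
  have n2 : ∏ j ∈ univ.erase i, (1 - x j * q ^ γ j / x i) ≠ 0 :=
    prod_ne_zero_iff.2 fun j hj => h1 j (ne_of_mem_erase hj)
  have n3 : ∏ j ∈ univ.erase i, (1 - q * x i / x j) ≠ 0 :=
    prod_ne_zero_iff.2 fun j hj => hq1 j (ne_of_mem_erase hj)
  have n4 := vdm_ne_zero hinj
  have n5 := vdm_ne_zero hinj'
  have hVd : vdm (fun j => x j * q ^ Function.update γ i (γ i + 1) j) / vdm x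
      = vdm (fun j => Function.update x i (x i * q) j * q ^ γ j)
          / vdm (Function.update x i (x i * q))
        * ((∏ j ∈ univ.erase i, (1 - q * x i / x j)) / ∏ j ∈ univ.erase i, (1 - x i / x j)) := by
    rw [← hE, hpt, div_mul_eq_mul_div, div_eq_div_iff n4 n5, hV]
    ring
  unfold homTerm
  rw [hVd, hP, hQ, hN, prod_div_distrib (s := univ.erase i) (f := fun j => 1 - x j / x i)]
  have alg (V P A Q C D₁ D₂ D₃ D₄ D₅ : ℂ) (hD₁ : D₁ ≠ 0) (hD₂ : D₂ ≠ 0) (hD₃ : D₃ ≠ 0)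
      (hD₅ : D₅ ≠ 0) :
      V * (D₃ / D₄) * (P * (A / (D₅ * D₃) * (D₁ / D₂))) * (Q * C) * (D₅ * D₂ / D₁)
        = V * P * Q * (A / D₄ * C) := by
    field_simp
  exact alg _ _ _ _ _ _ _ _ _ _ n1 n2 n3 h2

/-- The homogeneous sum of the terms `homTerm` of degree `N`. -/
noncomputable def homSum (q : ℂ) {n m : ℕ} (a x : Fin n → ℂ) (b Y : Fin m → ℂ) (c : ℂ)
    (N : ℕ) : ℂ :=
  ∑ γ ∈ piAntidiag univ N, homTerm q a x b Y c γ

/-- The residue coefficient attached to the dual variable `Y k`. -/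
noncomputable def dualCoeff {n m : ℕ} (a x : Fin n → ℂ) (b Y : Fin m → ℂ) (c : ℂ)
    (k : Fin m) : ℂ :=
  (∏ j, (a j - c * x j * Y k) / (1 - c * x j * Y k))
    * ((∏ l, (1 - b l * Y l / (c * Y k))) / ∏ l ∈ univ.erase k, (1 - Y l / Y k))

/-! ### The recurrence in the degree -/

theorem sum_eq_of_mem_piAntidiag {n N : ℕ} {γ : Fin n → ℕ}
    (h : γ ∈ piAntidiag (univ : Finset (Fin n)) N) : ∑ i, γ i = N :=
  (mem_piAntidiag.1 h).1

theorem le_of_mem_piAntidiag {n N : ℕ} {γ : Fin n → ℕ}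
    (h : γ ∈ piAntidiag (univ : Finset (Fin n)) N) (i : Fin n) : γ i ≤ N :=
  sum_eq_of_mem_piAntidiag h ▸ single_le_sum (f := γ) (fun _ _ => Nat.zero_le _) (mem_univ i)

theorem injective_shifted_point {q : ℂ} {n N : ℕ} {x : Fin n → ℂ} {γ : Fin n → ℕ} (hq : q ≠ 0)
    (hxx : ∀ i j, i ≠ j → ∀ r ≤ N, q ^ r * x i ≠ x j) (hγ : ∀ i, γ i ≤ N) :
    Function.Injective fun j => x j * q ^ γ j := by
  have main (i j : Fin n) (hle : γ i ≤ γ j) (h : x i * q ^ γ i = x j * q ^ γ j) : i = j := by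
    by_contra hij
    refine hxx j i (Ne.symm hij) (γ j - γ i) ((Nat.sub_le _ _).trans (hγ j)) ?_
    apply mul_right_cancel₀ (pow_ne_zero (γ i) hq)
    rw [h, mul_right_comm, ← pow_add, Nat.sub_add_cancel hle, mul_comm]
  intro i j h
  rcases le_total (γ i) (γ j) with hle | hle
  · exact main i j hle h
  · exact (main j i hle h.symm).symm

theorem sum_raise_coeff {q : ℂ} {n : ℕ} {x : Fin n → ℂ} (γ : Fin n → ℕ) (hq : q ≠ 0)
    (hx : ∀ j, x j ≠ 0) (hinj : Function.Injective fun j => x j * q ^ γ j) :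
    ∑ i, (∏ j, (1 - x i * q ^ γ i / x j))
        / ∏ j ∈ univ.erase i, (1 - x i * q ^ γ i / (x j * q ^ γ j))
      = 1 - q ^ ∑ i, γ i := by
  have hX (j : Fin n) : x j * q ^ γ j ≠ 0 := mul_ne_zero (hx j) (pow_ne_zero _ hq)
  -- Inverse points turn the ratios β_j/β_i into X_i/X_j with X_j = x_j q^{γ_j}.
  have h := sum_prod_one_sub_div (fun j => (x j)⁻¹) (fun j => (x j * q ^ γ j)⁻¹)
    (fun j => inv_ne_zero (hX j)) (fun i j hij => hinj (inv_injective hij))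
  have e : (∏ j, (x j)⁻¹) / ∏ j, (x j * q ^ γ j)⁻¹ = q ^ ∑ i, γ i := by
    rw [← prod_div_distrib, ← prod_pow_eq_pow_sum]
    refine prod_congr rfl fun j _ => ?_
    rw [div_inv_eq_mul, inv_mul_cancel_left₀ (hx j)]
  rw [e] at h
  simpa only [div_inv_eq_mul, inv_mul_eq_div] using h

theorem sum_raise_coeff_dual {q : ℂ} {n : ℕ} {x : Fin n → ℂ} (γ : Fin n → ℕ)
    (hx : ∀ j, x j ≠ 0) (hinj : Function.Injective x) :
    ∑ i, (∏ j, (1 - x j * q ^ γ j / x i)) / ∏ j ∈ univ.erase i, (1 - x j / x i)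
      = 1 - q ^ ∑ i, γ i := by
  rw [sum_prod_one_sub_div (fun j => x j * q ^ γ j) x hx hinj, ← prod_div_distrib,
    ← prod_pow_eq_pow_sum]
  congr 1
  exact prod_congr rfl fun j _ => mul_div_cancel_left₀ _ (hx j)

/-- One partial fraction with n + m nodes: the inverse points (x_i q^{γ_i})⁻¹ give the left side,
and the nodes c Y_k give the dual coefficients. -/
theorem sum_residues {q : ℂ} {n m : ℕ} (a : Fin n → ℂ) {x : Fin n → ℂ} (b : Fin m → ℂ)
    {Y : Fin m → ℂ} {c : ℂ} (γ : Fin n → ℕ) (hq : q ≠ 0) (hx : ∀ j, x j ≠ 0) (hY : ∀ k, Y k ≠ 0)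
    (hc : c ≠ 0) (hinj : Function.Injective fun j => x j * q ^ γ j) (hYinj : Function.Injective Y)
    (h0 : ∀ i k, 1 - c * x i * Y k ≠ 0) (h1 : ∀ i k, 1 - c * (x i * q ^ γ i) * Y k ≠ 0) :
    ∑ i, (∏ j, (1 - a j * (x i * q ^ γ i) / x j))
          / (∏ j ∈ univ.erase i, (1 - x i * q ^ γ i / (x j * q ^ γ j)))
          * ∏ k, (1 - b k * (x i * q ^ γ i) * Y k) / (1 - c * (x i * q ^ γ i) * Y k)
      = (1 - (∏ i, a i) * (∏ k, b k) / c ^ m * q ^ ∑ i, γ i)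
        - q ^ (∑ i, γ i) * ∑ k, dualCoeff a x b Y c k
          * ∏ i, (1 - c * x i * Y k) / (1 - c * (x i * q ^ γ i) * Y k) := by
  have hX (j : Fin n) : x j * q ^ γ j ≠ 0 := mul_ne_zero (hx j) (pow_ne_zero _ hq)
  have hcY (k : Fin m) : c * Y k ≠ 0 := mul_ne_zero hc (hY k)
  have h := sum_prod_one_sub_div
    (Sum.elim (fun j => a j / x j) (fun k => b k * Y k))
    (Sum.elim (fun j => (x j * q ^ γ j)⁻¹) (fun k => c * Y k))
    (by
      rintro (j | k)
      · exact inv_ne_zero (hX j)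
      · exact hcY k)
    (by
      rintro (i | k) (j | l) hij
      · exact congrArg _ (hinj (inv_injective hij))
      -- A collision of the two kinds of nodes would be a vanishing denominator.
      · refine absurd ?_ (h1 i l)
        have hij : (x i * q ^ γ i)⁻¹ = c * Y l := hij
        rw [mul_right_comm, ← hij, inv_mul_cancel₀ (hX i), sub_self]
      · refine absurd ?_ (h1 j k)
        have hij : c * Y k = (x j * q ^ γ j)⁻¹ := hij
        rw [mul_right_comm, hij, inv_mul_cancel₀ (hX j), sub_self]
      · exact congrArg _ (hYinj (mul_left_cancel₀ hc hij)))
  simp only [Fintype.sum_sum_type, Fintype.prod_sum_type, prod_erase_inl, prod_erase_inr,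
    Sum.elim_inl, Sum.elim_inr] at h
  rw [eq_sub_iff_add_eq, mul_sum]
  have e1 (i : Fin n) : (∏ j, (1 - a j * (x i * q ^ γ i) / x j))
          / (∏ j ∈ univ.erase i, (1 - x i * q ^ γ i / (x j * q ^ γ j)))
          * ∏ k, (1 - b k * (x i * q ^ γ i) * Y k) / (1 - c * (x i * q ^ γ i) * Y k)
      = (∏ j, (1 - a j / x j / (x i * q ^ γ i)⁻¹)) * (∏ k, (1 - b k * Y k / (x i * q ^ γ i)⁻¹))
        / ((∏ j ∈ univ.erase i, (1 - (x j * q ^ γ j)⁻¹ / (x i * q ^ γ i)⁻¹))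
          * ∏ k, (1 - c * Y k / (x i * q ^ γ i)⁻¹)) := by
    rw [mul_div_mul_comm, ← prod_div_distrib (s := univ) (ι := Fin m)]
    simp only [div_inv_eq_mul, mul_right_comm _ (Y _), div_mul_eq_mul_div, inv_mul_eq_div]
  have e2 (k : Fin m) : q ^ (∑ i, γ i) * (dualCoeff a x b Y c k
          * ∏ i, (1 - c * x i * Y k) / (1 - c * (x i * q ^ γ i) * Y k))
      = (∏ j, (1 - a j / x j / (c * Y k))) * (∏ l, (1 - b l * Y l / (c * Y k)))
        / ((∏ j, (1 - (x j * q ^ γ j)⁻¹ / (c * Y k)))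
          * ∏ l ∈ univ.erase k, (1 - c * Y l / (c * Y k))) := by
    have e3 : (∏ j, (1 - a j / x j / (c * Y k))) / ∏ j, (1 - (x j * q ^ γ j)⁻¹ / (c * Y k))
        = q ^ (∑ i, γ i) * ((∏ j, (a j - c * x j * Y k) / (1 - c * x j * Y k))
          * ∏ i, (1 - c * x i * Y k) / (1 - c * (x i * q ^ γ i) * Y k)) := by
      rw [← prod_pow_eq_pow_sum, ← prod_div_distrib, ← prod_mul_distrib, ← prod_mul_distrib]
      refine prod_congr rfl fun j _ => ?_
      rw [div_mul_div_cancel₀ (h0 j k)]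
      have u1 : 1 - a j / x j / (c * Y k) = -(a j - c * x j * Y k) / (x j * (c * Y k)) := by
        have := hx j
        have := hY k
        field_simp
        ring
      have u2 : 1 - (x j * q ^ γ j)⁻¹ / (c * Y k)
          = -(1 - c * (x j * q ^ γ j) * Y k) / (q ^ γ j * (x j * (c * Y k))) := by
        have := hx j
        have := hY k
        field_simp
        ring
      rw [u1, u2, div_div_div_eq, ← mul_assoc, mul_comm _ (x j * (c * Y k)), mul_div_mul_left _ _
        (mul_ne_zero (hx j) (hcY k)), neg_mul, neg_div_neg_eq, mul_comm, mul_div_assoc]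
    rw [mul_div_mul_comm, e3, dualCoeff]
    simp only [mul_div_mul_left _ _ hc]
    ring
  rw [sum_congr rfl fun i _ => e1 i, sum_congr rfl fun k _ => e2 k, h]
  congr 1
  have e4 : (∏ j, a j / x j) / ∏ j, (x j * q ^ γ j)⁻¹ = (∏ j, a j) * q ^ ∑ i, γ i := by
    rw [← prod_pow_eq_pow_sum, ← prod_div_distrib, ← prod_mul_distrib]
    refine prod_congr rfl fun j _ => ?_
    have := hx j
    field_simp
  have e5 : (∏ k, b k * Y k) / ∏ k, c * Y k = (∏ k, b k) / c ^ m := by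
    rw [← prod_div_distrib, prod_congr rfl fun k _ => mul_div_mul_right (b k) c (hY k),
      prod_div_distrib, prod_const, card_univ, Fintype.card_fin]
  rw [mul_div_mul_comm, e4, e5]
  ring

theorem one_sub_div_ne_zero {u v : ℂ} (hv : v ≠ 0) (h : u ≠ v) : 1 - u / v ≠ 0 := by
  rw [one_sub_div hv]
  exact div_ne_zero (sub_ne_zero.2 h.symm) hv

theorem homSum_succ {q : ℂ} {n m : ℕ} (a : Fin n → ℂ) {x : Fin n → ℂ} (b : Fin m → ℂ)
    {Y : Fin m → ℂ} {c : ℂ} (M : ℕ) (hq : q ≠ 0) (hq1 : ∀ r, q ^ (r + 1) ≠ 1)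
    (hx : ∀ j, x j ≠ 0) (hY : ∀ k, Y k ≠ 0) (hc : c ≠ 0)
    (hxx : ∀ i j, i ≠ j → ∀ r ≤ M + 1, q ^ r * x i ≠ x j) (hYinj : Function.Injective Y)
    (hcxy : ∀ i k, ∀ r < M + 1, c * x i * Y k * q ^ r ≠ 1) :
    (1 - q ^ (M + 1)) * homSum q a x b Y c (M + 1)
      = (1 - (∏ i, a i) * (∏ k, b k) / c ^ m * q ^ M) * homSum q a x b Y c M
        - q ^ M * ∑ k, dualCoeff a x b Y c k
          * homSum q a x (Function.update b k (b k * q⁻¹)) (Function.update Y k (Y k * q)) c M := by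
  have h0 (i : Fin n) (k : Fin m) : 1 - c * x i * Y k ≠ 0 :=
    sub_ne_zero.2 fun h => hcxy i k 0 M.succ_pos (by simpa using h.symm)
  -- The weights summing to 1 - q^{|γ|}; the i-th vanishes when γ_i = 0.
  let C : (Fin n → ℂ) → Fin n → ℂ := fun p i =>
    (∏ j, (1 - p i / x j)) / ∏ j ∈ univ.erase i, (1 - p i / p j)
  have hstart : (1 - q ^ (M + 1)) * homSum q a x b Y c (M + 1)
      = ∑ i, ∑ γ ∈ piAntidiag univ (M + 1),
          homTerm q a x b Y c γ * C (fun j => x j * q ^ γ j) i := by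
    rw [sum_comm, homSum, mul_sum]
    refine sum_congr rfl fun γ hγ => ?_
    rw [← mul_sum, mul_comm, sum_raise_coeff γ hq hx
      (injective_shifted_point hq hxx (le_of_mem_piAntidiag hγ)), sum_eq_of_mem_piAntidiag hγ]
  have hshift (i : Fin n) : ∑ γ ∈ piAntidiag univ (M + 1),
        homTerm q a x b Y c γ * C (fun j => x j * q ^ γ j) i
      = ∑ γ ∈ piAntidiag univ M, homTerm q a x b Y c γ
        * ((∏ j, (1 - a j * (x i * q ^ γ i) / x j))
          / (∏ j ∈ univ.erase i, (1 - x i * q ^ γ i / (x j * q ^ γ j)))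
          * ∏ k, (1 - b k * (x i * q ^ γ i) * Y k) / (1 - c * (x i * q ^ γ i) * Y k)) := by
    rw [sum_piAntidiag_succ M i]
    · refine sum_congr rfl fun γ hγ => ?_
      have hle := le_of_mem_piAntidiag hγ
      have hinj' := injective_shifted_point (γ := Function.update γ i (γ i + 1)) hq hxx fun j => by
        by_cases hj : j = i
        · subst hj
          simpa using hle j
        · simpa [hj] using (hle j).trans M.le_succ
      rw [shifted_point_update] at hinj'
      rw [shifted_point_update, ← homTerm_raise a b Y c γ i hq hx
        (injective_shifted_point hq hxx fun j => (hle j).trans M.le_succ)]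
      · congr 1
        simp only [C, Function.update_self]
        congr 1
        exact prod_congr rfl fun j hj => by rw [Function.update_of_ne (ne_of_mem_erase hj)]
      · intro j
        refine one_sub_div_ne_zero (hx j) ?_
        by_cases hj : j = i
        · subst hj
          intro h
          apply hq1 (γ j)
          apply mul_left_cancel₀ (hx j)
          rw [mul_one, pow_succ', mul_left_comm, h]
        · have := hxx i j (Ne.symm hj) (γ i + 1) (Nat.succ_le_succ (hle i))
          rwa [pow_succ', mul_assoc, mul_comm (q ^ γ i)] at this
      · intro j hj
        refine one_sub_div_ne_zero (mul_ne_zero (hx j) (pow_ne_zero _ hq)) fun h => hj ?_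
        apply hinj'
        simp only [Function.update_self, Function.update_of_ne hj]
        exact h.symm
    · intro γ hγ
      have : ∏ j, (1 - x i * q ^ γ i / x j) = 0 :=
        prod_eq_zero (mem_univ i) (by rw [hγ, pow_zero, mul_one, div_self (hx i), sub_self])
      simp only [C, this, zero_div, mul_zero]
  rw [hstart, sum_congr rfl fun i _ => hshift i, sum_comm]
  simp only [homSum, mul_sum]
  rw [sum_comm (s := univ), ← sum_sub_distrib]
  refine sum_congr rfl fun γ hγ => ?_
  have hle := le_of_mem_piAntidiag hγ
  rw [← mul_sum, sum_residues a b γ hq hx hY hc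
    (injective_shifted_point hq hxx fun j => (hle j).trans M.le_succ) hYinj h0
    (fun i k => sub_ne_zero.2 fun h => hcxy i k (γ i) (Nat.lt_succ_of_le (hle i)) (by
      rw [h]; ring)), sum_eq_of_mem_piAntidiag hγ, mul_sub, mul_comm, mul_sum, mul_sum]
  congr 1
  refine sum_congr rfl fun k _ => ?_
  rw [homTerm_update_dual a x b Y c γ k hq fun i => h0 i k]
  ring

/-! ### The recurrence for the dual series -/

/-- Up to the factor -t, the residue coefficient is the factor that `homTerm_raise_eq_update`
produces for the dual series, with (c/b, Y; c/a, x) in place of (a, x; b, Y). -/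
theorem dualCoeff_eq {n m : ℕ} {a x : Fin n → ℂ} {b Y : Fin m → ℂ} {c : ℂ} (k : Fin m)
    (ha : ∀ i, a i ≠ 0) (hb : ∀ l, b l ≠ 0) (hc : c ≠ 0) (hY : ∀ l, Y l ≠ 0) :
    dualCoeff a x b Y c k
      = -((∏ i, a i) * (∏ l, b l) / c ^ m)
        * ((∏ l, (1 - c / b l * Y k / Y l)) / (∏ l ∈ univ.erase k, (1 - Y k / Y l))
          * ∏ i, (1 - c / a i * Y k * x i) / (1 - c * Y k * x i)) := by
  have e1 : ∏ j, (a j - c * x j * Y k) / (1 - c * x j * Y k)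
      = (∏ i, a i) * ∏ i, (1 - c / a i * Y k * x i) / (1 - c * Y k * x i) := by
    rw [← prod_mul_distrib]
    refine prod_congr rfl fun j _ => ?_
    rw [mul_right_comm c, ← mul_div_assoc, mul_sub, mul_one, ← mul_assoc, ← mul_assoc,
      mul_div_cancel₀ _ (ha j)]
  have e2 : ∏ l, (1 - b l * Y l / (c * Y k))
      = ((∏ l, b l) / c ^ m) * ((∏ l, -(Y l / Y k)) * ∏ l, (1 - c / b l * Y k / Y l)) := by
    have : c ^ m = ∏ _l : Fin m, c := by simp
    rw [this, ← prod_div_distrib, ← prod_mul_distrib, ← prod_mul_distrib]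
    refine prod_congr rfl fun l _ => ?_
    have := hb l
    have := hY l
    have := hY k
    field_simp
    ring
  have e3 : ∏ l ∈ univ.erase k, (1 - Y l / Y k)
      = (∏ l ∈ univ.erase k, -(Y l / Y k)) * ∏ l ∈ univ.erase k, (1 - Y k / Y l) := by
    rw [← prod_mul_distrib]
    refine prod_congr rfl fun l _ => ?_
    have := hY l
    have := hY k
    field_simp
    ring
  -- The factor l = k equals -1; this is the source of the overall sign.
  have e4 : ∏ l, -(Y l / Y k) = -∏ l ∈ univ.erase k, -(Y l / Y k) := by
    rw [← mul_prod_erase univ _ (mem_univ k), div_self (hY k), neg_one_mul]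
  have n1 : ∏ l ∈ univ.erase k, -(Y l / Y k) ≠ 0 :=
    prod_ne_zero_iff.2 fun l _ => neg_ne_zero.2 (div_ne_zero (hY l) (hY k))
  rw [dualCoeff, e1, e2, e3, e4]
  have alg (A B C D E F : ℂ) (hF : F ≠ 0) :
      A * B * (C * (-F * D) / (F * E)) = -(A * C) * (D / E * B) := by
    field_simp
  rw [alg _ _ _ _ _ _ n1, mul_div_assoc]

theorem sum_dualCoeff_mul_homSum {q : ℂ} {n m : ℕ} {a x : Fin n → ℂ} {b : Fin m → ℂ}
    {Y : Fin m → ℂ} {c : ℂ} (L : ℕ) (hq : q ≠ 0) (hq1 : ∀ r, q ^ (r + 1) ≠ 1)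
    (ha : ∀ i, a i ≠ 0) (hb : ∀ l, b l ≠ 0) (hc : c ≠ 0) (hY : ∀ k, Y k ≠ 0)
    (hYY : ∀ i j, i ≠ j → ∀ r ≤ L + 1, q ^ r * Y i ≠ Y j) :
    ∑ k, dualCoeff a x b Y c k
        * homSum q (Function.update (fun l => c / b l) k (c / b k * q))
          (Function.update Y k (Y k * q)) (fun i => c / a i) x c L
      = -((∏ i, a i) * (∏ l, b l) / c ^ m) * (1 - q ^ (L + 1))
        * homSum q (fun l => c / b l) Y (fun i => c / a i) x c (L + 1) := by
  have hinj : Function.Injective Y := by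
    simpa using injective_shifted_point (γ := 0) hq hYY (by simp)
  have hinj' (k : Fin m) : Function.Injective (Function.update Y k (Y k * q)) := by
    have := injective_shifted_point (γ := Function.update 0 k 1) hq hYY fun j => by
      by_cases hj : j = k
      · subst hj
        simp
      · simp [hj]
    convert this using 1
    ext j
    by_cases hj : j = k
    · subst hj
      simp
    · simp [hj]
  have hterm (k : Fin m) : dualCoeff a x b Y c k
        * homSum q (Function.update (fun l => c / b l) k (c / b k * q))
          (Function.update Y k (Y k * q)) (fun i => c / a i) x c L
      = -((∏ i, a i) * (∏ l, b l) / c ^ m) * ∑ γ ∈ piAntidiag univ (L + 1),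
          homTerm q (fun l => c / b l) Y (fun i => c / a i) x c γ
          * ((∏ j, (1 - Y j * q ^ γ j / Y k)) / ∏ j ∈ univ.erase k, (1 - Y j / Y k)) := by
    rw [sum_piAntidiag_succ L k, homSum, mul_sum, mul_sum]
    · refine sum_congr rfl fun γ hγ => ?_
      rw [homTerm_raise_eq_update _ _ _ _ γ k hq hY hinj (hinj' k)
        (fun j hj => one_sub_div_ne_zero (hY k) fun h => hYY j k hj (γ j)
          ((le_of_mem_piAntidiag hγ j).trans L.le_succ) (by rw [mul_comm, h]))
        (sub_ne_zero.2 (hq1 _).symm), dualCoeff_eq k ha hb hc hY]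
      ring
    · intro γ hγ
      have : ∏ j, (1 - Y j * q ^ γ j / Y k) = 0 :=
        prod_eq_zero (mem_univ k) (by rw [hγ, pow_zero, mul_one, div_self (hY k), sub_self])
      rw [this, zero_div, mul_zero]
  simp only [hterm]
  rw [← mul_sum, sum_comm, mul_assoc]
  congr 1
  rw [homSum, mul_sum]
  refine sum_congr rfl fun γ hγ => ?_
  rw [← mul_sum, sum_raise_coeff_dual γ hY hinj, sum_eq_of_mem_piAntidiag hγ, mul_comm]

/-- The coefficient `(t)_k / (q)_k` of the `q`-binomial series. -/
noncomputable def qBinomCoeff (q t : ℂ) (k : ℕ) : ℂ := qShifted q t k / qShifted q q k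

/-! ### q-binomial coefficients -/

/-- Split 1 - q^{K+1+L} as (1 - q^{K+1}) + q^{K+1}(1 - q^L) and use (t)_{K+1} - (t/q)_{K+1} =
(t/q)(1 - q^{K+1})(t)_K. -/
theorem qBinomCoeff_recurrence {q : ℂ} (hq : q ≠ 0) (hq1 : ∀ r, q ^ (r + 1) ≠ 1) (t : ℂ)
    (K L : ℕ) :
    (1 - q ^ (K + 1 + L)) * qBinomCoeff q t (K + 1)
      = (1 - t * q ^ (K + L)) * qBinomCoeff q t K
        + q ^ (K + 1) * (1 - q ^ L) * qBinomCoeff q (t * q⁻¹) (K + 1) := by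
  have hn : qShifted q q K ≠ 0 := qShifted_ne_zero fun r _ => by rw [← pow_succ']; exact hq1 r
  have hn1 : 1 - q ^ (K + 1) ≠ 0 := sub_ne_zero.2 (hq1 K).symm
  unfold qBinomCoeff
  rw [qShifted_succ q q, qShifted_succ, qShifted_succ', inv_mul_cancel_right₀ hq,
    ← pow_succ' q]
  field_simp
  ring

/-- Holds for an arbitrary sequence G. With G the dual sums, the last sum matches the residue terms
of `homSum_succ`, because t becomes t/q under the dual shift. -/
theorem sum_qBinomCoeff_recurrence {q : ℂ} (hq : q ≠ 0) (hq1 : ∀ r, q ^ (r + 1) ≠ 1) (t : ℂ)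
    (G : ℕ → ℂ) (M : ℕ) :
    (1 - q ^ (M + 1)) * ∑ p ∈ antidiagonal (M + 1), qBinomCoeff q t p.1 * (t ^ p.2 * G p.2)
      = (1 - t * q ^ M) * ∑ p ∈ antidiagonal M, qBinomCoeff q t p.1 * (t ^ p.2 * G p.2)
        + q ^ M * ∑ p ∈ antidiagonal M, qBinomCoeff q (t * q⁻¹) p.1
          * ((t * q⁻¹) ^ p.2 * (t * (1 - q ^ (p.2 + 1)) * G (p.2 + 1))) := by
  let g : ℕ × ℕ → ℂ := fun p =>
    q ^ p.1 * (1 - q ^ p.2) * qBinomCoeff q (t * q⁻¹) p.1 * (t ^ p.2 * G p.2)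
  have hg : ∑ p ∈ antidiagonal (M + 1), g p
      = q ^ M * ∑ p ∈ antidiagonal M, qBinomCoeff q (t * q⁻¹) p.1
          * ((t * q⁻¹) ^ p.2 * (t * (1 - q ^ (p.2 + 1)) * G (p.2 + 1))) := by
    rw [Nat.sum_antidiagonal_succ', mul_sum]
    simp only [g, pow_zero, sub_self, mul_zero, zero_mul, zero_add]
    refine sum_congr rfl fun p hp => ?_
    rw [← mem_antidiagonal.1 hp, pow_add, mul_pow, inv_pow]
    have : q ^ p.2 ≠ 0 := pow_ne_zero _ hq
    field_simp
    ring
  have hh : ∑ p ∈ antidiagonal (M + 1),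
        ((1 - q ^ (M + 1)) * (qBinomCoeff q t p.1 * (t ^ p.2 * G p.2)) - g p)
      = (1 - t * q ^ M) * ∑ p ∈ antidiagonal M, qBinomCoeff q t p.1 * (t ^ p.2 * G p.2) := by
    rw [Nat.sum_antidiagonal_succ, mul_sum]
    -- At K = 0 the coefficient is 1 for t and for t/q alike, so the two contributions cancel.
    have h0 : (1 - q ^ (M + 1)) * (qBinomCoeff q t 0 * (t ^ (M + 1) * G (M + 1)))
        - g (0, M + 1) = 0 := by
      simp [g, qBinomCoeff, qShifted_zero]
    rw [h0, zero_add]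
    refine sum_congr rfl fun p hp => ?_
    have h := qBinomCoeff_recurrence hq hq1 t p.1 p.2
    rw [add_right_comm, mem_antidiagonal.1 hp] at h
    simp only [g]
    rw [← mul_assoc, h]
    ring
  rw [← hg, ← hh, sum_sub_distrib, mul_sum, sub_add_cancel]

/-! ### The Euler transformation -/

theorem homSum_zero {q : ℂ} {n m : ℕ} (a : Fin n → ℂ) {x : Fin n → ℂ} (b Y : Fin m → ℂ) (c : ℂ)
    (hinj : Function.Injective x) : homSum q a x b Y c 0 = 1 := by
  simp [homSum, homTerm, qShifted_zero, div_self (vdm_ne_zero hinj)]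

/-- The Euler transformation of Kajihara, degree by degree. -/
theorem homSum_euler {q : ℂ} {n m : ℕ} {a x : Fin n → ℂ} {c : ℂ} (hq : q ≠ 0)
    (hq1 : ∀ r, q ^ (r + 1) ≠ 1) (ha : ∀ i, a i ≠ 0) (hx : ∀ i, x i ≠ 0) (hc : c ≠ 0) (M : ℕ)
    (hxx : ∀ i j, i ≠ j → ∀ r ≤ M, q ^ r * x i ≠ x j) (b Y : Fin m → ℂ)
    (hb : ∀ k, b k ≠ 0) (hY : ∀ k, Y k ≠ 0)
    (hYY : ∀ k l, k ≠ l → ∀ r ≤ M, q ^ r * Y k ≠ Y l)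
    (hcxy : ∀ i k, ∀ r < M, c * x i * Y k * q ^ r ≠ 1) :
    homSum q a x b Y c M
      = ∑ p ∈ antidiagonal M, qBinomCoeff q ((∏ i, a i) * (∏ k, b k) / c ^ m) p.1
        * (((∏ i, a i) * (∏ k, b k) / c ^ m) ^ p.2
          * homSum q (fun k => c / b k) Y (fun i => c / a i) x c p.2) := by
  -- The recurrence calls degree M at (b_k/q, q Y_k), so `b` and `Y` must vary.
  induction M generalizing b Y with
  | zero =>
    rw [homSum_zero a b Y c (by simpa using injective_shifted_point (γ := 0) hq hxx (by simp))]
    simp [qBinomCoeff, qShifted_zero, homSum_zero (fun k => c / b k) (fun i => c / a i) x c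
      (by simpa using injective_shifted_point (γ := 0) hq hYY (by simp))]
  | succ M ih =>
    have hYinj : Function.Injective Y := by
      simpa using injective_shifted_point (γ := 0) hq hYY (by simp)
    have ihM := ih (fun i j hij r hr => hxx i j hij r (hr.trans M.le_succ))
    apply mul_left_cancel₀ (sub_ne_zero.2 (hq1 M).symm)
    rw [homSum_succ a b M hq hq1 hx hY hc hxx hYinj hcxy, sum_qBinomCoeff_recurrence hq hq1,
      ihM b Y hb hY (fun k l hkl r hr => hYY k l hkl r (hr.trans M.le_succ))
        (fun i k r hr => hcxy i k r (hr.trans M.lt_succ_self)), sub_eq_add_neg, ← mul_neg]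
    congr 2
    have hk (k : Fin m) : homSum q a x (Function.update b k (b k * q⁻¹))
          (Function.update Y k (Y k * q)) c M
        = ∑ p ∈ antidiagonal M,
          qBinomCoeff q ((∏ i, a i) * (∏ k, b k) / c ^ m * q⁻¹) p.1
          * (((∏ i, a i) * (∏ k, b k) / c ^ m * q⁻¹) ^ p.2
            * homSum q (Function.update (fun l => c / b l) k (c / b k * q))
              (Function.update Y k (Y k * q)) (fun i => c / a i) x c p.2) := by
      rw [ihM]
      · have e1 : (∏ i, a i) * (∏ l, Function.update b k (b k * q⁻¹) l) / c ^ m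
            = (∏ i, a i) * (∏ k, b k) / c ^ m * q⁻¹ := by
          rw [prod_update_div]
          ring
        have e2 : (fun l => c / Function.update b k (b k * q⁻¹) l)
            = Function.update (fun l => c / b l) k (c / b k * q) := by
          ext l
          by_cases hl : l = k
          · subst hl
            rw [Function.update_self, Function.update_self, div_mul_eq_div_div, div_inv_eq_mul]
          · simp [hl]
        rw [e1, e2]
      · intro l
        by_cases hl : l = k
        · subst hl
          simpa using ⟨hb l, hq⟩
        · simpa [hl] using hb l
      · intro l
        by_cases hl : l = k
        · subst hl
          simpa using ⟨hY l, hq⟩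
        · simpa [hl] using hY l
      · intro j l hjl r hr
        by_cases hj : j = k
        · subst hj
          rw [Function.update_self, Function.update_of_ne hjl.symm, mul_comm (Y j), ← mul_assoc,
            ← pow_succ]
          exact hYY j l hjl _ (Nat.succ_le_succ hr)
        · rw [Function.update_of_ne hj]
          by_cases hl : l = k
          · subst hl
            rw [Function.update_self]
            -- The shift of Y_l lowers the exponent by one; for r = 0 the nonvanishing comes from
            -- the reversed pair with exponent 1.
            cases r with
            | zero =>
              rw [pow_zero, one_mul, mul_comm]
              simpa using (hYY l j hjl.symm 1 (Nat.succ_le_succ M.zero_le)).symm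
            | succ r =>
              rw [pow_succ', mul_assoc, mul_comm (Y l)]
              exact fun h => hYY j l hjl r (by omega) (mul_left_cancel₀ hq h)
          · rw [Function.update_of_ne hl]
            exact hYY j l hjl r (hr.trans M.le_succ)
      · intro i l r hr
        by_cases hl : l = k
        · subst hl
          have := hcxy i l (r + 1) (Nat.succ_lt_succ hr)
          rwa [pow_succ', ← mul_assoc, mul_assoc _ _ q, ← Function.update_self (f := Y) l (Y l * q)]
            at this
        · rw [Function.update_of_ne hl]
          exact hcxy i l r (hr.trans M.lt_succ_self)
    simp only [hk, mul_sum]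
    rw [sum_comm, ← sum_neg_distrib]
    refine sum_congr rfl fun p hp => ?_
    have hp2 : p.2 ≤ M := HasAntidiagonal.antidiagonal.snd_le hp
    have hd := sum_dualCoeff_mul_homSum (a := a) (x := x) (b := b) p.2 hq hq1 ha hb hc hY
      (fun i j hij r hr => hYY i j hij r (hr.trans (Nat.succ_le_succ hp2)))
    simp only [mul_left_comm (dualCoeff _ _ _ _ _ _)]
    rw [← mul_sum, ← mul_sum, hd]
    ring

/-! ### Restoring the normalisation; the master formula -/

theorem homPart_eq_homSum (q : ℂ) {n m : ℕ} [NeZero n] [NeZero m] (a x : Fin n → ℂ)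
    (b y : Fin m → ℂ) (c : ℂ) (N : ℕ) :
    homPart q a x b y c N
      = homSum q a x b (fun k => y k / (x (lastIdx n) * y (lastIdx m))) c N := by
  refine sum_congr rfl fun γ _ => ?_
  simp only [homTerm, mul_div_assoc]

/-- Only the ratios x_i/x_j and the products x_i Y_k enter, so a scale factor may pass between the
two sets. This carries the normaliser x_n y_m to the dual side, where it has the same value. -/
theorem homSum_div {q : ℂ} {n m : ℕ} (a x : Fin n → ℂ) (b y : Fin m → ℂ) (c : ℂ) {s : ℂ}
    (hs : s ≠ 0) (N : ℕ) :
    homSum q a (fun i => x i / s) b y c N = homSum q a x b (fun k => y k / s) c N := by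
  refine sum_congr rfl fun γ _ => ?_
  have h := vdm_smul_ratio (inv_ne_zero hs) x (fun i => q ^ γ i)
  simp only [inv_mul_eq_div] at h
  unfold homTerm
  rw [h]
  congr 2
  · refine prod_congr rfl fun i _ => prod_congr rfl fun j _ => ?_
    rw [← mul_div_assoc, ← mul_div_assoc, div_div_div_cancel_right₀ hs,
      div_div_div_cancel_right₀ hs]
  · ext i
    refine prod_congr rfl fun k _ => ?_
    congr 2 <;> ring

theorem homPart_euler {q : ℂ} (hq : q ≠ 0) (hq1 : ∀ r, q ^ (r + 1) ≠ 1) {n m : ℕ} [NeZero n]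
    [NeZero m] (a x : Fin n → ℂ) (b y : Fin m → ℂ) (c : ℂ) (N : ℕ)
    (ha : ∀ i, a i ≠ 0) (hb : ∀ k, b k ≠ 0) (hc : c ≠ 0) (hx : ∀ i, x i ≠ 0) (hy : ∀ k, y k ≠ 0)
    (hxx : ∀ i j, i ≠ j → ∀ r ≤ N, q ^ r * x i ≠ x j)
    (hyy : ∀ k l, k ≠ l → ∀ r ≤ N, q ^ r * y k ≠ y l)
    (hcxy : ∀ i k, ∀ r < N, c * x i * y k / (x (lastIdx n) * y (lastIdx m)) * q ^ r ≠ 1) :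
    homPart q a x b y c N
      = ∑ p ∈ antidiagonal N, qBinomCoeff q ((∏ i, a i) * (∏ k, b k) / c ^ m) p.1
        * (((∏ i, a i) * (∏ k, b k) / c ^ m) ^ p.2
          * homPart q (fun k => c / b k) y (fun i => c / a i) x c p.2) := by
  have hs : x (lastIdx n) * y (lastIdx m) ≠ 0 := mul_ne_zero (hx _) (hy _)
  rw [homPart_eq_homSum, homSum_euler hq hq1 ha hx hc N hxx b _ hb (fun k => div_ne_zero (hy k) hs)]
  · refine sum_congr rfl fun p _ => ?_
    rw [homSum_div _ _ _ _ _ hs, homPart_eq_homSum, mul_comm (y _)]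
  · intro k l hkl r hr h
    rw [← mul_div_assoc] at h
    exact hyy k l hkl r hr ((div_left_inj' hs).1 h)
  · intro i k r hr
    rw [← mul_div_assoc]
    exact hcxy i k r hr

/-- Commutativity and associativity of the product of three power series. -/
theorem sum_antidiagonal_triple {R : Type*} [CommRing R] (P G H : ℕ → R) (N : ℕ) :
    ∑ p ∈ antidiagonal N, (∑ r ∈ antidiagonal p.1, P r.1 * G r.2) * H p.2
      = ∑ p ∈ antidiagonal N, G p.1 * ∑ r ∈ antidiagonal p.2, P r.1 * H r.2 := by
  have h := congrArg (PowerSeries.coeff N)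
    (show PowerSeries.mk P * PowerSeries.mk G * PowerSeries.mk H
      = PowerSeries.mk G * (PowerSeries.mk P * PowerSeries.mk H) by ring)
  simpa only [PowerSeries.coeff_mul, PowerSeries.coeff_mk] using h

theorem theorem3p1 (q : ℂ) (hq0 : 0 < ‖q‖) (hq1 : ‖q‖ < 1) (N : ℕ)
    {n₁ m₁ n₂ m₂ : ℕ} [NeZero n₁] [NeZero m₁] [NeZero n₂] [NeZero m₂]
    (a x : Fin n₁ → ℂ) (b y : Fin m₁ → ℂ) (c : ℂ)
    (e z : Fin n₂ → ℂ) (d w : Fin m₂ → ℂ) (f : ℂ)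
    -- all parameters and variables are nonzero
    (ha : ∀ i, a i ≠ 0) (hb : ∀ k, b k ≠ 0) (hc : c ≠ 0)
    (hd : ∀ s, d s ≠ 0) (he : ∀ p, e p ≠ 0) (hf : f ≠ 0)
    (hx : ∀ i, x i ≠ 0) (hy : ∀ k, y k ≠ 0) (hz : ∀ p, z p ≠ 0) (hw : ∀ s, w s ≠ 0)
    -- no denominator in the formula vanishes
    (hxx : ∀ i j, i ≠ j → ∀ r ≤ N, q ^ r * x i ≠ x j)
    (hyy : ∀ k l, k ≠ l → ∀ r ≤ N, q ^ r * y k ≠ y l)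
    (hzz : ∀ p t, p ≠ t → ∀ r ≤ N, q ^ r * z p ≠ z t)
    (hww : ∀ s t, s ≠ t → ∀ r ≤ N, q ^ r * w s ≠ w t)
    (hcxy : ∀ i k, ∀ r < N, c * x i * y k / (x (lastIdx n₁) * y (lastIdx m₁)) * q ^ r ≠ 1)
    (hfzw : ∀ p s, ∀ r < N, f * z p * w s / (z (lastIdx n₂) * w (lastIdx m₂)) * q ^ r ≠ 1)
    -- the totally balancing condition
    (hbal : (∏ i, a i) * (∏ k, b k) / c ^ m₁ = (∏ s, d s) * (∏ p, e p) / f ^ n₂) :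
    ∑ K ∈ Finset.range (N + 1),
        homPart q a x b y c K
          * homPart q (fun p => f / e p) z (fun s => f / d s) w f (N - K)
          * ((∏ s, d s) * (∏ p, e p) / f ^ n₂) ^ (N - K)
      = ∑ L ∈ Finset.range (N + 1),
        homPart q (fun k => c / b k) y (fun i => c / a i) x c L
          * homPart q d w e z f (N - L)
          * ((∏ i, a i) * (∏ k, b k) / c ^ m₁) ^ L := by
  have hq : q ≠ 0 := norm_pos_iff.1 hq0
  have hqr (r : ℕ) : q ^ (r + 1) ≠ 1 := fun h => by
    have h' := pow_lt_one₀ (norm_nonneg q) hq1 r.succ_ne_zero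
    rw [← norm_pow, h, norm_one] at h'
    exact lt_irrefl _ h'
  have h1 (K : ℕ) (hK : K ≤ N) := homPart_euler hq hqr a x b y c K ha hb hc hx hy
    (fun i j hij r hr => hxx i j hij r (hr.trans hK))
    (fun i j hij r hr => hyy i j hij r (hr.trans hK))
    (fun i k r hr => hcxy i k r (hr.trans_le hK))
  -- The transformation is applied to the (d, w; e, z) series of the right side; its dual is the
  -- second series of the left side.
  have h2 (K : ℕ) (hK : K ≤ N) := homPart_euler hq hqr d w e z f K hd he hf hw hz
    (fun i j hij r hr => hww i j hij r (hr.trans hK))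
    (fun i j hij r hr => hzz i j hij r (hr.trans hK))
    (fun s p r hr => by
      have := hfzw p s r (hr.trans_le hK)
      rwa [mul_right_comm f, mul_comm (z _)] at this)
  rw [← hbal] at h2 ⊢
  set t := (∏ i, a i) * (∏ k, b k) / c ^ m₁
  have key := sum_antidiagonal_triple (qBinomCoeff q t)
    (fun L => t ^ L * homPart q (fun k => c / b k) y (fun i => c / a i) x c L)
    (fun L => t ^ L * homPart q (fun p => f / e p) z (fun s => f / d s) w f L) N
  rw [sum_congr rfl fun p hp => congrArg (· * (t ^ p.2 * homPart q (fun p => f / e p) z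
      (fun s => f / d s) w f p.2)) (h1 p.1 (HasAntidiagonal.antidiagonal.fst_le hp)).symm,
    sum_congr rfl fun p hp => congrArg (t ^ p.1 * homPart q (fun k => c / b k) y
      (fun i => c / a i) x c p.1 * ·) (h2 p.2 (HasAntidiagonal.antidiagonal.snd_le hp)).symm,
    Nat.sum_antidiagonal_eq_sum_range_succ_mk, Nat.sum_antidiagonal_eq_sum_range_succ_mk] at key
  convert key using 1
  · exact sum_congr rfl fun K _ => by ring
  · exact sum_congr rfl fun L _ => by ring
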